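/- Let $\mathcal S,\mathcal A,\mathcal O$ be finite with $\mathcal A,\mathcal O\neq\emptyset$, let $\mathcal Y$ be a measurable space and $T\in\mathbb N$. Consider a class of $T$-step MDPs parametrized by $\theta\in\mathcal O$: given $\theta$, the first state has a law $\mathbb P_{S_1\mid\theta}$; at step $t$ the agent chooses $A_t$ from the current state $S_t$ and the history $H^t=\big((S_i,A_i,Y_i)\big)_{i<t}$; the outcome is $Y_t\sim y(\cdot\mid S_t,\theta)$, conditionally independent of $A_t$; the reward is $r(Y_t,A_t)$ with $r$ measurable and $0\le r\le1$; and $S_{t+1}\sim p(\cdot\mid S_t,A_t,\theta)$. The class is a contextual bandit $\mathcal C$: $p(\cdot\mid s,a,\theta)$ depends neither on the previous state $s$ nor on the action $a$. A (deterministic) policy $\pi$ is a sequence of measurable maps $(S_t,H^t)\mapsto A_t$; let $\mathcal P$ be the set of policies. For a possibly randomized algorithm $\pi$ let $U(\pi,\theta)=\mathbb E^\theta\big[\sum_{t=1}^T r(Y_t,A_t)\big]$, let $U^*(\theta)$ be the supremum of $U(f,\theta)$ over $f:\mathcal S\to\mathcal A$ (playing $A_t=f(S_t)$), and let $\mathfrak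 R(\pi,\theta)=U^*(\theta)-U(\pi,\theta)$. For a prior $\mathbb P_\Theta$ on $\mathcal O$ put $$\mathfrak{BR}_{\mathcal C}(\pi,\mathbb P_\Theta)=\mathbb E_{\Theta\sim\mathbb P_\Theta}[\mathfrak R(\pi,\Theta)],\qquad \mathfrak F_{\mathcal C}(\mathbb P_\Theta)=\inf_{\pi\in\mathcal P}\mathfrak{BR}_{\mathcal C}(\pi,\mathbb P_\Theta),\qquad \mathfrak M_{\mathcal C}=\inf_{\mathbb P_\Pi\in\Delta(\mathcal P)}\sup_{\theta\in\mathcal O}\mathbb E_{\Pi\sim\mathbb P_\Pi}[\mathfrak R(\Pi,\theta)],$$ where $\Delta(\mathcal P)$ is the set of probability measures on $\mathcal P$ (with the Borel $\sigma$-algebra of the discrete metric). Let $H(\Theta)=-\sum_\theta \mathbb P_\Theta(\theta)\log\mathbb P_\Theta(\theta)$, with natural logarithm. Given $\mathbb P_\Theta$, an optimal rule is a maximizer $f^\star$ of $\mathbb E\big[\sum_{t=1}^T r(Y_t,f(S_t,\Theta))\big]$ over $f:\mathcal S\times\mathcal O\to\mathcal A$. Thompson sampling $\hat\pi$ draws,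 at each step $t$, $\hat\Theta_t$ from the posterior law of $\Theta$ given its history $H^t$ and plays $A_t=f^\star(S_t,\hat\Theta_t)$. Then for every prior $\mathbb P_\Theta$ on $\mathcal O$ an optimal rule exists; for every optimal rule, Thompson sampling satisfies $$\mathfrak{BR}_{\mathcal C}(\hat\pi,\mathbb P_\Theta)\le\sqrt{\frac{|\mathcal A|\,T\,H(\Theta)}{2}};$$ and $$\mathfrak F_{\mathcal C}(\mathbb P_\Theta)\le\sqrt{\frac{|\mathcal A|\,T\,H(\Theta)}{2}}.$$ Moreover $$\mathfrak M_{\mathcal C}\le\sqrt{\frac{|\mathcal A|\,T\,\log|\mathcal O|}{2}},$$ so that $\mathfrak M_{\mathcal C}=O\big(\sqrt{|\mathcal A|\,T\log|\mathcal O|}\big)$ with an absolute constant. -/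

import Mathlib

open MeasureTheory ProbabilityTheory

namespace MinimaxRL

noncomputable section

/-- A class of finite-horizon Markov decision processes with state space `S`, action space `A`,
outcome space `Y`, parametrized by `θ : O`: given `θ`, the first state has law `init θ`, the next
state has law `trans (s, a, θ)`, the outcome has law `out (s, θ)`, the reward is the deterministic
function `reward y a` of the outcome and the action, and there are `horizon` time steps. -/
structure MDP (S A O Y : Type*) [MeasurableSpace S] [MeasurableSpace A] [MeasurableSpace O]
    [MeasurableSpace Y] where
  init : Kernel O S
  trans : Kernel (S × A × O) S
  out : Kernel (S × O) Y
  reward : Y → A → ℝ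
  horizon : ℕ
  markov_init : IsMarkovKernel init
  markov_trans : IsMarkovKernel trans
  markov_out : IsMarkovKernel out
  measurable_reward : Measurable (fun z : Y × A => reward z.1 z.2)

attribute [instance] MDP.markov_init MDP.markov_trans MDP.markov_out

/-- Histories after `t` completed steps: the triples (state, action, outcome) of these steps. -/
abbrev Hist (S A Y : Type*) (t : ℕ) : Type _ := Fin t → S × A × Y

/-- Append one step to a history. -/
def Hist.snoc {S A Y : Type*} {t : ℕ} (h : Hist S A Y t) (x : S × A × Y) : Hist S A Y (t + 1) :=
  Fin.snoc (α := fun _ => S × A × Y) h x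

variable {S A O Y : Type*} [MeasurableSpace S] [MeasurableSpace A] [MeasurableSpace O]
  [MeasurableSpace Y]

theorem measurable_snoc {t : ℕ} :
    Measurable (fun z : Hist S A Y t × (S × A × Y) => Hist.snoc z.1 z.2) := by
  refine measurable_pi_iff.mpr fun i => ?_
  induction i using Fin.lastCases with
  | last => simpa [Hist.snoc] using measurable_snd
  | cast i =>
    have h : Measurable (fun z : Hist S A Y t × (S × A × Y) => z.1 i) := by fun_prop
    simpa [Hist.snoc] using h

variable (S A Y) in
/-- A (deterministic) policy: at each time a measurable function of the history and the current
state. Time is indexed from `0`; only the times below the horizon matter. -/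
structure Policy where
  act : ∀ t : ℕ, Hist S A Y t × S → A
  measurable_act : ∀ t, Measurable (act t)

/-- The set of policies carries the Borel `σ`-algebra of the discrete metric, so that every
function of the policy is measurable. -/
instance : MeasurableSpace (Policy S A Y) := ⊤

variable (S A Y) in
/-- An algorithm that may randomize at each time: the law of the action given the history and the
current state. -/
structure RandPolicy where
  act : ∀ t : ℕ, Kernel (Hist S A Y t × S) A
  markov_act : ∀ t, IsMarkovKernel (act t)

attribute [instance] RandPolicy.markov_act

/-- A deterministic policy as a (degenerate) randomized one. -/
def Policy.toRand (π : Policy S A Y) : RandPolicy S A Y where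
  act t := Kernel.deterministic (π.act t) (π.measurable_act t)
  markov_act _ := inferInstance

/-- The policy that plays `f s` in state `s`, whatever the history. -/
def Policy.stationary (f : S → A) (hf : Measurable f) : Policy S A Y where
  act _ x := f x.2
  measurable_act _ := hf.comp measurable_snd

namespace MDP

variable (M : MDP S A O Y)

/-- The law, given `θ`, of (empty history, first state). -/
def start : Kernel O (Hist S A Y 0 × S) := M.init.map (fun s => (Fin.elim0, s))

/-- One step: if `κ θ` is the law of (history, current state) at time `t`, the action is drawn
from `α`, the outcome from `out` (conditionally independently of the action), the next state from
`trans`, and the result is the law of (history, current state) at time `t + 1`. -/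
def step {t : ℕ} (κ : Kernel O (Hist S A Y t × S)) (α : Kernel (Hist S A Y t × S) A) :
    Kernel O (Hist S A Y (t + 1) × S) :=
  (((κ ⊗ₖ α.comap (fun z : O × (Hist S A Y t × S) => z.2) (by fun_prop))
      ⊗ₖ M.out.comap (fun z : O × ((Hist S A Y t × S) × A) => (z.2.1.2, z.1)) (by fun_prop))
      ⊗ₖ M.trans.comap (fun z : O × (((Hist S A Y t × S) × A) × Y) =>
          (z.2.1.1.2, z.2.1.2, z.1)) (by fun_prop)).map
    (fun z : (((Hist S A Y t × S) × A) × Y) × S =>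
      (Hist.snoc z.1.1.1.1 (z.1.1.1.2, z.1.1.2, z.1.2), z.2))

instance : IsMarkovKernel M.start :=
  Kernel.IsMarkovKernel.map _ (by fun_prop)

instance {t : ℕ} (κ : Kernel O (Hist S A Y t × S)) (α : Kernel (Hist S A Y t × S) A)
    [IsMarkovKernel κ] [IsMarkovKernel α] : IsMarkovKernel (M.step κ α) := by
  refine Kernel.IsMarkovKernel.map _ (Measurable.prodMk ?_ measurable_snd)
  have h : Measurable (fun z : (((Hist S A Y t × S) × A) × Y) × S =>
      (z.1.1.1.1, (z.1.1.1.2, z.1.1.2, z.1.2))) := by fun_prop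
  exact measurable_snoc.comp h

/-- The law, given `θ`, of (history, current state) at time `t` under the algorithm `φ`. -/
def law (φ : RandPolicy S A Y) : ∀ t : ℕ, Kernel O (Hist S A Y t × S)
  | 0 => M.start
  | t + 1 => M.step (law φ t) (φ.act t)

/-- Utility: expected cumulative reward over the horizon. -/
def utility (φ : RandPolicy S A Y) (θ : O) : ℝ :=
  ∫ z, ∑ i, M.reward (z.1 i).2.2 (z.1 i).2.1 ∂(M.law φ M.horizon θ)

/-- Optimal utility: supremum over the maps from states to actions. -/
def optUtility (θ : O) : ℝ :=
  ⨆ f : {f : S → A // Measurable f}, M.utility (Policy.stationary f.1 f.2).toRand θ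

/-- Regret. -/
def regret (φ : RandPolicy S A Y) (θ : O) : ℝ := M.optUtility θ - M.utility φ θ

/-- Bayesian regret under the prior `P`. -/
def bayesRegret (φ : RandPolicy S A Y) (P : Measure O) : ℝ := ∫ θ, M.regret φ θ ∂P

/-- Minimum Bayesian regret: infimum over the (deterministic) policies. -/
def minBayesRegret (P : Measure O) : ℝ := ⨅ π : Policy S A Y, M.bayesRegret π.toRand P

/-- Minimax regret: infimum over probability measures on the set of policies of the worst-case
expected regret. -/
def minimaxRegret : ℝ :=
  ⨅ Q : ProbabilityMeasure (Policy S A Y), ⨆ θ : O,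
    ∫ π : Policy S A Y, M.regret π.toRand θ ∂(Q : Measure (Policy S A Y))

/-- Contextual bandit: the law of the next state depends neither on the previous state nor on the
action. -/
def IsContextualBandit : Prop :=
  ∀ (s s' : S) (a a' : A) (θ : O), M.trans (s, a, θ) = M.trans (s', a', θ)

/-- The expected cumulative reward, under the prior `P`, of an agent that knows the parameter and
plays `f (s, θ)`. -/
def oracleUtility (P : Measure O) (f : S × O → A) (hf : Measurable f) : ℝ :=
  ∫ θ, M.utility (Policy.stationary (fun s => f (s, θ)) (hf.comp (by fun_prop))).toRand θ ∂P

/-- `f` maximizes the expected cumulative reward among all maps `S × O → A`. -/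
def IsOptimalRule (P : Measure O) (f : S × O → A) : Prop :=
  ∃ hf : Measurable f, ∀ (g : S × O → A) (hg : Measurable g),
    M.oracleUtility P g hg ≤ M.oracleUtility P f hf

section Thompson

variable [StandardBorelSpace O] [Nonempty O]

/-- The Thompson sampling action when `κ θ` is the law of (history, current state) given `θ`:
draw `θ'` from the posterior of the parameter given the history, then play `f (s, θ')`. -/
def thompsonAct (P : Measure O) [IsProbabilityMeasure P] (f : S × O → A) {t : ℕ}
    (κ : Kernel O (Hist S A Y t × S)) [IsMarkovKernel κ] : Kernel (Hist S A Y t × S) A :=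
  (((posterior κ.fst P).comap (fun z : Hist S A Y t × S => z.1) (by fun_prop)) ×ₖ
    Kernel.deterministic (fun z : Hist S A Y t × S => z.2) (by fun_prop)).map
      (fun z : O × S => f (z.2, z.1))

theorem isMarkovKernel_thompsonAct (P : Measure O) [IsProbabilityMeasure P] {f : S × O → A}
    (hf : Measurable f) {t : ℕ} (κ : Kernel O (Hist S A Y t × S)) [IsMarkovKernel κ] :
    IsMarkovKernel (thompsonAct P f κ) :=
  Kernel.IsMarkovKernel.map _ (by fun_prop)

/-- The law of (history, current state) at time `t` given `θ` under Thompson sampling. -/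
def thompsonLaw (P : Measure O) [IsProbabilityMeasure P] (f : S × O → A) (hf : Measurable f) :
    ∀ t : ℕ, {κ : Kernel O (Hist S A Y t × S) // IsMarkovKernel κ}
  | 0 => ⟨M.start, inferInstance⟩
  | t + 1 =>
    let κ := thompsonLaw P f hf t
    haveI := κ.2
    haveI := isMarkovKernel_thompsonAct P hf κ.1
    ⟨M.step κ.1 (thompsonAct P f κ.1), inferInstance⟩

/-- Thompson sampling with prior `P` and decision rule `f`: at each time the parameter is sampled
from its posterior given the history produced by Thompson sampling itself. -/
def thompson (P : Measure O) [IsProbabilityMeasure P] (f : S × O → A) (hf : Measurable f) :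
    RandPolicy S A Y where
  act t := haveI := (M.thompsonLaw P f hf t).2; thompsonAct P f (M.thompsonLaw P f hf t).1
  markov_act t := haveI := (M.thompsonLaw P f hf t).2; isMarkovKernel_thompsonAct P hf _

theorem law_thompson (P : Measure O) [IsProbabilityMeasure P] (f : S × O → A) (hf : Measurable f)
    (t : ℕ) : M.law (M.thompson P f hf) t = (M.thompsonLaw P f hf t).1 := by
  induction t with
  | zero => rfl
  | succ t ih =>
    change M.step (M.law (M.thompson P f hf) t) _ = _
    rw [ih]
    rfl

end Thompson

end MDP

/-- Shannon entropy (in nats) of a probability measure on a finite set. -/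
def entropy {O : Type*} [Fintype O] [MeasurableSpace O] (P : Measure O) : ℝ :=
  ∑ θ, Real.negMulLog (P.real {θ})

end

end MinimaxRL

namespace MinimaxRL

/-! ### Bounded integrals, Bayes' formula on a finite parameter space, Hoeffding's lemma -/

section Prelim

/-! The outcome does not depend on the action, so the pair (state, outcome) reveals the reward of
every action: this is learning with full information. The argument gives `√(T H / 2)`, and the
factor `|A|` is only slack.

Fix a parameter `θ` and let `g` be the reward of the rule `f (·, θ)` as a function of state and
outcome. Under the Bayesian mixture law of the history, the exponential of the sum of `η (g -
posterior mean of g) - η² / 8` has expectation at most one, by Hoeffding's lemma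
(`exists_exp_supermartingale`). The law given `θ`, weighted by its prior mass, is dominated by the
mixture. Hence the expected sum given `θ` is at most `-log P(θ)` (`mul_sum_sub_posteriorMean_le`).
Averaging over `θ` produces the entropy, and the choice of `η` produces the square root.

It remains to recognize the averaged posterior means as an attainable reward. Given the history, the
true parameter and a posterior sample are exchangeable, so these means are the expected reward of
playing `f` for a sampled parameter (`sum_integral_posteriorMean`). Thompson sampling earns exactly
this. The deterministic policy that is greedy for the posterior earns at least as much, which bounds
the minimum Bayesian regret.

The minimax bound follows by duality: a hyperplane separating a constant vector from the risk
vectors of randomized policies is a prior (`minimaxRegret_le`), and the entropy is at most `log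
|O|`. -/

theorem integrable_of_abs_le {X : Type*} [MeasurableSpace X] {μ : Measure X} [IsFiniteMeasure μ]
    {f : X → ℝ} (hf : Measurable f) {C : ℝ} (hC : ∀ x, |f x| ≤ C) : Integrable f μ :=
  Integrable.of_bound hf.aestronglyMeasurable C (ae_of_all _ hC)

theorem abs_integral_le {X : Type*} [MeasurableSpace X] {μ : Measure X} [IsProbabilityMeasure μ]
    {f : X → ℝ} {C : ℝ} (hC : ∀ x, |f x| ≤ C) : |∫ x, f x ∂μ| ≤ C := by
  have h := norm_integral_le_of_norm_le_const (μ := μ) (f := f) (C := C) (ae_of_all _ hC)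
  simpa using h

theorem integral_mem_Icc {X : Type*} [MeasurableSpace X] {μ : Measure X} [IsProbabilityMeasure μ]
    {f : X → ℝ} (hf : Measurable f) (h : ∀ x, f x ∈ Set.Icc (0 : ℝ) 1) :
    ∫ x, f x ∂μ ∈ Set.Icc (0 : ℝ) 1 := by
  refine ⟨integral_nonneg fun x => (h x).1, ?_⟩
  have := integral_mono (μ := μ) (integrable_of_abs_le hf (C := 1) fun x => by
    rw [abs_of_nonneg (h x).1]; exact (h x).2) (integrable_const 1) fun x => (h x).2
  simpa using this

theorem abs_le_one_of_mem_Icc {x : ℝ} (h : x ∈ Set.Icc (0 : ℝ) 1) : |x| ≤ 1 := by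
  rw [abs_of_nonneg h.1]; exact h.2

section Finite

variable {O : Type*} [MeasurableSpace O] [DiscreteMeasurableSpace O] [Fintype O]

theorem integral_eq_sum (P : Measure O) [IsFiniteMeasure P] (f : O → ℝ) :
    ∫ θ, f θ ∂P = ∑ θ, P.real {θ} * f θ := by
  rw [integral_fintype .of_finite]; rfl

theorem sum_measureReal_singleton (P : Measure O) [IsProbabilityMeasure P] :
    ∑ θ, P.real {θ} = 1 := by
  simp

theorem abs_average_le (P : Measure O) [IsProbabilityMeasure P] {f : O → ℝ} {C : ℝ}
    (hf : ∀ θ, |f θ| ≤ C) : |∑ θ, P.real {θ} * f θ| ≤ C := by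
  rw [← integral_eq_sum]; exact abs_integral_le hf

theorem exists_probabilityMeasure_real_singleton {p : O → ℝ} (hp : ∀ θ, 0 ≤ p θ)
    (hsum : ∑ θ, p θ = 1) :
    ∃ P : Measure O, IsProbabilityMeasure P ∧ ∀ θ, P.real {θ} = p θ := by
  have h : ∑ θ, ENNReal.ofReal (p θ) = 1 := by
    rw [← ENNReal.ofReal_sum_of_nonneg fun θ _ => hp θ, hsum, ENNReal.ofReal_one]
  refine ⟨(PMF.ofFintype _ h).toMeasure, inferInstance, fun θ => ?_⟩
  rw [Measure.real, PMF.toMeasure_apply_singleton _ _ (measurableSet_singleton θ),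
    PMF.ofFintype_apply, ENNReal.toReal_ofReal (hp θ)]

variable {X : Type*} [MeasurableSpace X]

/-- Bayes' theorem for a finite parameter space, tested against bounded functions. -/
theorem sum_integral_eq_integral_posterior [Nonempty O] (P : Measure O) [IsProbabilityMeasure P]
    (κ : Kernel O X) [IsMarkovKernel κ] {F : O → X → ℝ} (hF : ∀ θ, Measurable (F θ)) {C : ℝ}
    (hC : ∀ θ x, |F θ x| ≤ C) :
    ∑ θ, P.real {θ} * ∫ x, F θ x ∂κ θ
      = ∫ x, ∑ θ, (posterior κ P x).real {θ} * F θ x ∂(P.bind κ) := by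
  have hm : Measurable (fun z : X × O => F z.2 z.1) :=
    measurable_from_prod_countable_left fun θ => hF θ
  have hm' : Measurable (fun z : O × X => F z.1 z.2) :=
    hm.comp measurable_swap
  have h := congrArg (fun μ => ∫ z : X × O, F z.2 z.1 ∂μ)
    (compProd_posterior_eq_map_swap (κ := κ) (μ := P))
  rw [integral_map (by fun_prop) hm.aestronglyMeasurable] at h
  simp only [Prod.fst_swap, Prod.snd_swap] at h
  rw [Measure.integral_compProd (integrable_of_abs_le hm fun z => hC _ _),
    Measure.integral_compProd (integrable_of_abs_le hm' fun z => hC _ _), integral_eq_sum P] at h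
  simp only [fun x => integral_eq_sum (posterior κ P x)] at h
  exact h.symm

theorem integral_bind_eq_sum [Nonempty O] (P : Measure O) [IsProbabilityMeasure P]
    (κ : Kernel O X) [IsMarkovKernel κ] {F : X → ℝ} (hF : Measurable F) {C : ℝ}
    (hC : ∀ x, |F x| ≤ C) :
    ∫ x, F x ∂(P.bind κ) = ∑ θ, P.real {θ} * ∫ x, F x ∂κ θ := by
  rw [sum_integral_eq_integral_posterior P κ (F := fun _ => F) (fun _ => hF) (fun _ => hC)]
  simp [← Finset.sum_mul]

theorem measurable_posterior_real [Nonempty O] (P : Measure O) [IsProbabilityMeasure P]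
    (κ : Kernel O X) [IsMarkovKernel κ] (θ : O) :
    Measurable (fun x => (posterior κ P x).real {θ}) :=
  ((posterior κ P).measurable_coe (measurableSet_singleton θ)).ennreal_toReal

/-- Hoeffding's lemma for a mixture. -/
theorem sum_integral_exp_le (ρ : Measure O) [IsProbabilityMeasure ρ] (J : Kernel O X)
    [IsMarkovKernel J] {g : X → ℝ} (hg : Measurable g) (h : ∀ x, g x ∈ Set.Icc (0 : ℝ) 1)
    (η : ℝ) :
    ∑ θ, ρ.real {θ} * ∫ x, Real.exp (η * g x) ∂J θ
      ≤ Real.exp (η * ∑ θ, ρ.real {θ} * ∫ x, g x ∂J θ + η ^ 2 / 8) := by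
  have hg2 : Measurable (fun z : O × X => g z.2) := by fun_prop
  have hexp : ∀ x, |Real.exp (η * g x)| ≤ Real.exp |η| := fun x => by
    rw [abs_of_pos (Real.exp_pos _), Real.exp_le_exp]
    calc η * g x ≤ |η * g x| := le_abs_self _
      _ = |η| * |g x| := abs_mul _ _
      _ ≤ |η| * 1 := by gcongr; exact abs_le_one_of_mem_Icc (h x)
      _ = |η| := mul_one _
  have e1 : ∑ θ, ρ.real {θ} * ∫ x, g x ∂J θ = ∫ z : O × X, g z.2 ∂(ρ ⊗ₘ J) := by
    rw [Measure.integral_compProd (integrable_of_abs_le hg2 fun z => abs_le_one_of_mem_Icc (h _)),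
      integral_eq_sum]
  have e2 : ∑ θ, ρ.real {θ} * ∫ x, Real.exp (η * g x) ∂J θ
      = ∫ z : O × X, Real.exp (η * g z.2) ∂(ρ ⊗ₘ J) := by
    rw [Measure.integral_compProd (integrable_of_abs_le (by fun_prop) fun z => hexp _),
      integral_eq_sum]
  rw [e1, e2]
  set m := ∫ z : O × X, g z.2 ∂(ρ ⊗ₘ J)
  -- A variable in `[0, 1]` has variance proxy `(1/2)²`, whence the exponent `η² / 8`.
  have key := (hasSubgaussianMGF_of_mem_Icc (μ := ρ ⊗ₘ J) hg2.aemeasurable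
    (ae_of_all _ fun z => h z.2)).mgf_le η
  have e3 : mgf (fun z : O × X => g z.2 - m) (ρ ⊗ₘ J) η
      = Real.exp (-(η * m)) * ∫ z : O × X, Real.exp (η * g z.2) ∂(ρ ⊗ₘ J) := by
    rw [mgf, ← integral_const_mul]
    congr 1; ext z
    rw [← Real.exp_add]; ring_nf
  change mgf (fun z : O × X => g z.2 - m) (ρ ⊗ₘ J) η ≤ _ at key
  rw [e3, Real.exp_neg, inv_mul_le_iff₀ (Real.exp_pos _), ← Real.exp_add] at key
  refine key.trans (le_of_eq ?_)
  congr 1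
  norm_num
  ring

end Finite

/-- A family of real functions indexed by a finite set has a measurable maximizer. -/
theorem exists_measurable_argmax {X A : Type*} [MeasurableSpace X] [MeasurableSpace A]
    [DiscreteMeasurableSpace A] [Fintype A] [Nonempty A] {v : X → A → ℝ}
    (hv : ∀ a, Measurable fun x => v x a) :
    ∃ g : X → A, Measurable g ∧ ∀ x a, v x a ≤ v x (g x) := by
  classical
  -- The set of maximizers depends measurably on `x` as an element of a finite discrete space; any
  -- fixed choice function on that space then breaks ties measurably.
  let _ : MeasurableSpace (Finset A) := ⊤
  have hne : ∀ x, ∃ a, ∀ b, v x b ≤ v x a := fun x => Finite.exists_max (v x)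
  let B : X → Finset A := fun x => Finset.univ.filter fun a => ∀ b, v x b ≤ v x a
  have hB : Measurable B := by
    refine measurable_to_countable' fun s => ?_
    have : B ⁻¹' {s} = ⋂ a : A, {x | (∀ b, v x b ≤ v x a) ↔ a ∈ s} := by
      ext x; simp [B, Finset.ext_iff]
    rw [this]
    refine MeasurableSet.iInter fun a => ?_
    have h1 : MeasurableSet {x | ∀ b, v x b ≤ v x a} := by
      rw [Set.ofPred_forall]
      exact MeasurableSet.iInter fun b => measurableSet_le (hv b) (hv a)
    by_cases ha : a ∈ s
    · simpa [ha] using h1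
    · simpa [ha, Set.compl_ofPred] using h1.compl
  let c : Finset A → A := fun s => if h : s.Nonempty then h.choose else Classical.arbitrary A
  refine ⟨fun x => c (B x), (measurable_from_top (f := c)).comp hB, fun x a => ?_⟩
  have h : (B x).Nonempty := by
    obtain ⟨a, ha⟩ := hne x
    exact ⟨a, by simpa [B] using ha⟩
  have h2 : c (B x) ∈ B x := by
    simp only [c, dif_pos h]; exact h.choose_spec
  simp only [B, Finset.mem_filter, Finset.mem_univ, true_and] at h2
  exact h2 a

/-- Optimization over the learning rate. -/
theorem le_sqrt_of_forall_mul_le {R T H : ℝ} (hT : 0 ≤ T) (hH : 0 ≤ H)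
    (h : ∀ η : ℝ, 0 < η → η * R ≤ H + T * (η ^ 2 / 8)) : R ≤ √(T * H / 2) := by
  rcases le_or_gt R 0 with hR | hR
  · exact hR.trans (Real.sqrt_nonneg _)
  apply Real.le_sqrt_of_sq_le
  rcases hT.eq_or_lt with rfl | hT
  -- When `T = 0` the left side is unbounded in `η`; this value gives `H + 1 ≤ H`.
  · have := h ((H + 1) / R) (by positivity)
    rw [div_mul_cancel₀ _ hR.ne'] at this
    linarith
  -- The maximizer of `η R - T η² / 8`.
  · have := h (4 * R / T) (by positivity)
    have e : 4 * R / T * R - T * ((4 * R / T) ^ 2 / 8) = 2 * R ^ 2 / T := by field_simp; ring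
    have h2 : 2 * R ^ 2 / T ≤ H := by linarith
    rw [div_le_iff₀ hT] at h2
    linarith

end Prelim

end MinimaxRL

/-! ### Laws, utilities and regret in a contextual bandit -/

namespace MinimaxRL

noncomputable section

namespace MDP

variable {S A O Y : Type*} [MeasurableSpace S] [MeasurableSpace A] [MeasurableSpace O]
  [MeasurableSpace Y] (M : MDP S A O Y)

instance isMarkovKernel_law (φ : RandPolicy S A Y) : ∀ t, IsMarkovKernel (M.law φ t)
  | 0 => inferInstanceAs (IsMarkovKernel M.start)
  | t + 1 =>
    haveI := isMarkovKernel_law φ t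
    inferInstanceAs (IsMarkovKernel (M.step (M.law φ t) (φ.act t)))

/-- The law of the state at time `t` in a contextual bandit; the reference state and action are
immaterial. -/
def stateLaw (s₀ : S) (a₀ : A) : ℕ → Kernel O S
  | 0 => M.init
  | _ + 1 => M.trans.comap (fun θ => (s₀, a₀, θ)) (by fun_prop)

instance (s₀ : S) (a₀ : A) : ∀ t, IsMarkovKernel (M.stateLaw s₀ a₀ t)
  | 0 => inferInstanceAs (IsMarkovKernel M.init)
  | _ + 1 => inferInstanceAs (IsMarkovKernel (M.trans.comap (fun θ => (s₀, a₀, θ)) (by fun_prop)))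

/-- The law of the pair (state, outcome) at time `t` in a contextual bandit. -/
def obsLaw (s₀ : S) (a₀ : A) (t : ℕ) : Kernel O (S × Y) :=
  M.stateLaw s₀ a₀ t ⊗ₖ M.out.comap (fun z : O × S => (z.2, z.1)) (by fun_prop)

instance (s₀ : S) (a₀ : A) (t : ℕ) : IsMarkovKernel (M.obsLaw s₀ a₀ t) :=
  inferInstanceAs (IsMarkovKernel (_ ⊗ₖ _))

theorem measurable_snoc_step {t : ℕ} : Measurable
    (fun z : (((Hist S A Y t × S) × A) × Y) =>
      Hist.snoc z.1.1.1 (z.1.1.2, z.1.2, z.2)) := by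
  have h : Measurable (fun z : (((Hist S A Y t × S) × A) × Y) =>
      (z.1.1.1, (z.1.1.2, z.1.2, z.2))) := by fun_prop
  exact measurable_snoc.comp h

/-- The first factor of a product of probability measures is its marginal, so independence can be
proved with any convenient description of the history law. -/
theorem fst_eq_and_eq_prod_of_eq_prod {X : Type*} [MeasurableSpace X] {κ : Kernel O (X × S)}
    {θ : O} {m : Measure X} {q : Measure S} [IsProbabilityMeasure m] [IsProbabilityMeasure q]
    (h : κ θ = m.prod q) : κ θ = (κ.fst θ).prod q := by
  rw [Kernel.fst_apply, h]
  change _ = (m.prod q).fst.prod q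
  rw [Measure.fst_prod]

/-- In a contextual bandit the current state is independent of the history given the
parameter. -/
theorem law_eq_prod (hM : M.IsContextualBandit) (s₀ : S) (a₀ : A) (φ : RandPolicy S A Y) (t : ℕ)
    (θ : O) : M.law φ t θ = ((M.law φ t).fst θ).prod (M.stateLaw s₀ a₀ t θ) := by
  cases t with
  | zero =>
    refine fst_eq_and_eq_prod_of_eq_prod (m := Measure.dirac Fin.elim0) ?_
    change M.start θ = (Measure.dirac Fin.elim0).prod (M.init θ)
    rw [start, Kernel.map_apply _ (by fun_prop), Measure.dirac_prod]
  | succ t =>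
    set ρ : Kernel O (((Hist S A Y t × S) × A) × Y) := (M.law φ t ⊗ₖ
      (φ.act t).comap (fun z : O × (Hist S A Y t × S) => z.2) (by fun_prop))
      ⊗ₖ M.out.comap (fun z : O × ((Hist S A Y t × S) × A) => (z.2.1.2, z.1)) (by fun_prop) with hρ
    have : IsProbabilityMeasure ((ρ θ).map (fun z : (((Hist S A Y t × S) × A) × Y) =>
      Hist.snoc z.1.1.1 (z.1.1.2, z.1.2, z.2))) :=
      Measure.isProbabilityMeasure_map measurable_snoc_step.aemeasurable
    refine fst_eq_and_eq_prod_of_eq_prod (m := (ρ θ).map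
      (fun z => Hist.snoc z.1.1.1 (z.1.1.2, z.1.2, z.2))) ?_
    change M.step (M.law φ t) (φ.act t) θ = _
    have hmeas : Measurable (fun z : (((Hist S A Y t × S) × A) × Y) × S =>
        (Hist.snoc z.1.1.1.1 (z.1.1.1.2, z.1.1.2, z.1.2), z.2)) :=
      (measurable_snoc_step.comp measurable_fst).prodMk measurable_snd
    rw [step, Kernel.map_apply _ hmeas, ← hρ, Kernel.compProd_apply_eq_compProd_sectR]
    -- The bandit hypothesis enters here: for fixed `θ` the transition kernel is constant, so
    -- appending the next state is a product of measures.
    have hc : (M.trans.comap (fun z : O × (((Hist S A Y t × S) × A) × Y) =>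
          (z.2.1.1.2, z.2.1.2, z.1)) (by fun_prop)).sectR θ
        = Kernel.const _ (M.stateLaw s₀ a₀ (t + 1) θ) := by
      ext1 z
      simp only [Kernel.sectR_apply, Kernel.comap_apply, Kernel.const_apply, stateLaw]
      exact hM _ _ _ _ _
    rw [hc, Measure.compProd_const, ← Measure.map_id (μ := M.stateLaw s₀ a₀ (t + 1) θ),
      Measure.map_prod_map _ _ measurable_snoc_step measurable_id, Measure.map_id]
    rfl

theorem integral_law_fst (φ : RandPolicy S A Y) (t : ℕ) (θ : O) {F : Hist S A Y t → ℝ}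
    (hF : Measurable F) :
    ∫ z, F z.1 ∂(M.law φ t θ) = ∫ h, F h ∂((M.law φ t).fst θ) := by
  rw [Kernel.fst_apply, integral_map (by fun_prop) hF.aestronglyMeasurable]

/-- The next state is not part of the history, so its kernel integrates out with mass one. -/
theorem integral_fst_law_succ (φ : RandPolicy S A Y) (t : ℕ) (θ : O)
    {F : Hist S A Y (t + 1) → ℝ} (hF : Measurable F) {C : ℝ} (hC : ∀ h, |F h| ≤ C) :
    ∫ h, F h ∂((M.law φ (t + 1)).fst θ)
      = ∫ z, ∫ a, ∫ y, F (Hist.snoc z.1 (z.2, a, y)) ∂(M.out (z.2, θ)) ∂(φ.act t z)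
          ∂(M.law φ t θ) := by
  have hmeas : Measurable (fun z : (((Hist S A Y t × S) × A) × Y) × S =>
      (Hist.snoc z.1.1.1.1 (z.1.1.1.2, z.1.1.2, z.1.2), z.2)) :=
    (measurable_snoc_step.comp measurable_fst).prodMk measurable_snd
  have hF1 : Measurable (fun z : Hist S A Y (t + 1) × S => F z.1) := by fun_prop
  have hF2 : Measurable (fun z : (((Hist S A Y t × S) × A) × Y) =>
      F (Hist.snoc z.1.1.1 (z.1.1.2, z.1.2, z.2))) := hF.comp measurable_snoc_step
  rw [← M.integral_law_fst φ (t + 1) θ hF]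
  change ∫ z, F z.1 ∂(M.step (M.law φ t) (φ.act t) θ) = _
  rw [step, Kernel.map_apply _ hmeas, integral_map hmeas.aemeasurable hF1.aestronglyMeasurable]
  have hF3 : Measurable (fun z : (((Hist S A Y t × S) × A) × Y) × S =>
      F (Hist.snoc z.1.1.1.1 (z.1.1.1.2, z.1.1.2, z.1.2))) := hF2.comp measurable_fst
  rw [ProbabilityTheory.integral_compProd (integrable_of_abs_le hF3 fun z => hC _)]
  simp only [integral_const, probReal_univ, one_smul]
  rw [ProbabilityTheory.integral_compProd (integrable_of_abs_le hF2 fun z => hC _)]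
  rw [ProbabilityTheory.integral_compProd]
  · rfl
  · refine Integrable.integral_compProd (f := fun z : (((Hist S A Y t × S) × A) × Y) =>
      F (Hist.snoc z.1.1.1 (z.1.1.2, z.1.2, z.2))) ?_
    exact integrable_of_abs_le hF2 fun z => hC _

/-- Integrals of functions of the past and of the current state and outcome. -/
theorem integral_fst_law_succ_obs (hM : M.IsContextualBandit) (s₀ : S) (a₀ : A)
    (φ : RandPolicy S A Y) (t : ℕ) (θ : O) {F : Hist S A Y t → S × Y → ℝ}
    (hF : Measurable (fun z : Hist S A Y t × (S × Y) => F z.1 z.2)) {C : ℝ}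
    (hC : ∀ h x, |F h x| ≤ C) :
    ∫ h, F (fun i => h i.castSucc) ((h (Fin.last t)).1, (h (Fin.last t)).2.2)
        ∂((M.law φ (t + 1)).fst θ)
      = ∫ h, ∫ x, F h x ∂(M.obsLaw s₀ a₀ t θ) ∂((M.law φ t).fst θ) := by
  have hm : Measurable (fun h : Hist S A Y (t + 1) =>
      ((fun i => h i.castSucc : Hist S A Y t), ((h (Fin.last t)).1, (h (Fin.last t)).2.2))) := by
    fun_prop
  have hFm : Measurable (fun h : Hist S A Y (t + 1) =>
      F (fun i => h i.castSucc) ((h (Fin.last t)).1, (h (Fin.last t)).2.2)) := hF.comp hm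
  rw [M.integral_fst_law_succ φ t θ hFm fun h => hC _ _]
  -- The integrand ignores the action, and the outcome is drawn independently of it, so the kernel
  -- of `φ` disappears: this is the full-information property.
  simp only [Hist.snoc, Fin.snoc_castSucc, Fin.snoc_last, integral_const, probReal_univ, one_smul]
  rw [M.law_eq_prod hM s₀ a₀ φ t θ, integral_prod]
  · refine integral_congr_ae (ae_of_all _ fun h => ?_)
    have hFh : Measurable (F h) := hF.comp (measurable_prodMk_left (x := h))
    change _ = ∫ x, F h x ∂(M.obsLaw s₀ a₀ t θ)
    rw [obsLaw, ProbabilityTheory.integral_compProd (integrable_of_abs_le hFh (hC h))]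
    rfl
  · refine Integrable.of_bound (C := C) (Measurable.aestronglyMeasurable ?_)
      (ae_of_all _ fun z => abs_integral_le fun y => hC _ _)
    have : Measurable (fun w : (Hist S A Y t × S) × Y => F w.1.1 (w.1.2, w.2)) :=
      hF.comp (f := fun w : (Hist S A Y t × S) × Y => (w.1.1, (w.1.2, w.2))) (by fun_prop)
    exact (this.stronglyMeasurable.integral_kernel_prod_right'
      (κ := M.out.comap (fun z : Hist S A Y t × S => (z.2, θ)) (by fun_prop))).measurable

/-- Expected reward of the action `a` in state `s` given the parameter. -/
def meanReward (s : S) (θ : O) (a : A) : ℝ := ∫ y, M.reward y a ∂(M.out (s, θ))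

/-- Expected reward at time `t` given the parameter. -/
def stepUtility (φ : RandPolicy S A Y) (t : ℕ) (θ : O) : ℝ :=
  ∫ z, ∫ a, M.meanReward z.2 θ a ∂(φ.act t z) ∂(M.law φ t θ)

theorem measurable_reward_comp {X : Type*} [MeasurableSpace X] {f : X → Y} {g : X → A}
    (hf : Measurable f) (hg : Measurable g) : Measurable (fun x => M.reward (f x) (g x)) :=
  M.measurable_reward.comp (hf.prodMk hg)

theorem meanReward_mem_Icc (hr : ∀ y a, M.reward y a ∈ Set.Icc (0 : ℝ) 1) (s : S) (θ : O)
    (a : A) : M.meanReward s θ a ∈ Set.Icc (0 : ℝ) 1 :=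
  integral_mem_Icc (M.measurable_reward_comp measurable_id measurable_const) fun y => hr y a

theorem utility_eq_sum (hr : ∀ y a, M.reward y a ∈ Set.Icc (0 : ℝ) 1) (φ : RandPolicy S A Y)
    (θ : O) : M.utility φ θ = ∑ t ∈ Finset.range M.horizon, M.stepUtility φ t θ := by
  have hrew : ∀ t (i : Fin t), Measurable
      (fun h : Hist S A Y t => M.reward (h i).2.2 (h i).2.1) := fun t i =>
    M.measurable_reward_comp (by fun_prop) (by fun_prop)
  have hsum : ∀ t, Measurable (fun h : Hist S A Y t => ∑ i, M.reward (h i).2.2 (h i).2.1) :=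
    fun t => Finset.measurable_sum _ fun i _ => hrew t i
  have habs : ∀ y a, |M.reward y a| ≤ 1 := fun y a => abs_le_one_of_mem_Icc (hr y a)
  -- Stated for every length rather than for `M.horizon`, so that induction applies.
  have key : ∀ n, ∫ h, ∑ i, M.reward (h i).2.2 (h i).2.1 ∂((M.law φ n).fst θ)
      = ∑ t ∈ Finset.range n, M.stepUtility φ t θ := by
    intro n
    induction n with
    | zero => simp
    | succ n ih =>
      have hb : ∀ h : Hist S A Y n, |∑ i, M.reward (h i).2.2 (h i).2.1| ≤ n := fun h => by
        refine (Finset.abs_sum_le_sum_abs _ _).trans ((Finset.sum_le_sum fun i _ =>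
          habs _ _).trans ?_)
        simp
      have hinit : Measurable (fun h : Hist S A Y (n + 1) =>
          ∑ i : Fin n, M.reward (h i.castSucc).2.2 (h i.castSucc).2.1) :=
        Finset.measurable_sum _ fun i _ => hrew (n + 1) i.castSucc
      simp only [Fin.sum_univ_castSucc]
      rw [integral_add (integrable_of_abs_le hinit
          (fun h => hb (fun i => h i.castSucc)))
          (integrable_of_abs_le (hrew (n + 1) (Fin.last n)) fun h => habs _ _),
        M.integral_fst_law_succ φ n θ hinit (fun h => hb (fun i => h i.castSucc)),
        M.integral_fst_law_succ φ n θ (hrew (n + 1) (Fin.last n)) fun h => habs _ _]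
      simp only [Hist.snoc, Fin.snoc_castSucc, Fin.snoc_last, integral_const, probReal_univ,
        one_smul]
      rw [M.integral_law_fst φ n θ (hsum n), ih, Finset.sum_range_succ]
      rfl
  rw [utility, M.integral_law_fst φ M.horizon θ (hsum _), key]

theorem stepUtility_mem_Icc [DiscreteMeasurableSpace S] [DiscreteMeasurableSpace A]
    [Countable S] [Countable A]
    (hr : ∀ y a, M.reward y a ∈ Set.Icc (0 : ℝ) 1) (φ : RandPolicy S A Y) (t : ℕ) (θ : O) :
    M.stepUtility φ t θ ∈ Set.Icc (0 : ℝ) 1 := by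
  refine integral_mem_Icc ?_ fun z => integral_mem_Icc .of_discrete fun a =>
    M.meanReward_mem_Icc hr _ _ _
  have : Measurable (fun w : (Hist S A Y t × S) × A => M.meanReward w.1.2 θ w.2) :=
    (Measurable.of_discrete (f := fun p : S × A => M.meanReward p.1 θ p.2)).comp
      (g := fun p : S × A => M.meanReward p.1 θ p.2)
      (f := fun w : (Hist S A Y t × S) × A => (w.1.2, w.2)) (by fun_prop)
  exact (this.stronglyMeasurable.integral_kernel_prod_right' (κ := φ.act t)).measurable

/-- Reward, as a function of state and outcome, of the action that the rule `f` takes for the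
parameter `θ`. -/
def ruleReward (f : S × O → A) (θ : O) (x : S × Y) : ℝ := M.reward x.2 (f (x.1, θ))

theorem measurable_ruleReward [DiscreteMeasurableSpace S] (f : S × O → A) (θ : O) :
    Measurable (M.ruleReward f θ) :=
  M.measurable_reward_comp measurable_snd
    ((Measurable.of_discrete (f := fun s => f (s, θ))).comp measurable_fst)

theorem integral_ruleReward [DiscreteMeasurableSpace S]
    (hr : ∀ y a, M.reward y a ∈ Set.Icc (0 : ℝ) 1) (s₀ : S) (a₀ : A)
    (f : S × O → A) (t : ℕ) (θ θ' : O) :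
    ∫ x, M.ruleReward f θ' x ∂(M.obsLaw s₀ a₀ t θ)
      = ∫ s, M.meanReward s θ (f (s, θ')) ∂(M.stateLaw s₀ a₀ t θ) := by
  rw [obsLaw, ProbabilityTheory.integral_compProd (integrable_of_abs_le
    (M.measurable_ruleReward f θ') fun x => abs_le_one_of_mem_Icc (hr _ _))]
  rfl

theorem measurable_meanReward_comp [DiscreteMeasurableSpace S] [DiscreteMeasurableSpace A]
    [Countable S] [Countable A] {X : Type*} [MeasurableSpace X] (θ : O) {σ : X → S}
    {α : X → A} (hσ : Measurable σ) (hα : Measurable α) :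
    Measurable (fun x => M.meanReward (σ x) θ (α x)) :=
  (Measurable.of_discrete (f := fun p : S × A => M.meanReward p.1 θ p.2)).comp
    (g := fun p : S × A => M.meanReward p.1 θ p.2) (f := fun x => (σ x, α x)) (hσ.prodMk hα)

theorem abs_meanReward_le (hr : ∀ y a, M.reward y a ∈ Set.Icc (0 : ℝ) 1) (s : S) (θ : O) (a : A) :
    |M.meanReward s θ a| ≤ 1 :=
  abs_le_one_of_mem_Icc (M.meanReward_mem_Icc hr s θ a)

theorem oracleUtility_eq [DiscreteMeasurableSpace S] [DiscreteMeasurableSpace O] [Fintype O]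
    (P : Measure O) [IsProbabilityMeasure P]
    (f : S × O → A) (hf : Measurable f) : M.oracleUtility P f hf =
      ∑ θ, P.real {θ} * M.utility (Policy.stationary (fun s => f (s, θ)) .of_discrete).toRand θ := by
  rw [oracleUtility, integral_eq_sum]

theorem exists_isOptimalRule [DiscreteMeasurableSpace S] [DiscreteMeasurableSpace O] [Finite S]
    [Finite O] [Finite A] [Nonempty A] (P : Measure O) :
    ∃ f : S × O → A, M.IsOptimalRule P f := by
  obtain ⟨f, hf⟩ := Finite.exists_max fun f : S × O → A => M.oracleUtility P f .of_discrete
  exact ⟨f, .of_discrete, fun g _ => hf g⟩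

/-- A bound uniform in the algorithm ensures that the real infima and suprema over policies are
genuine, not default values of unbounded families. -/
theorem exists_abs_regret_le [DiscreteMeasurableSpace S] [DiscreteMeasurableSpace A]
    [Countable S] [Countable A] [Fintype O]
    (hr : ∀ y a, M.reward y a ∈ Set.Icc (0 : ℝ) 1) :
    ∃ C, ∀ (φ : RandPolicy S A Y) (θ : O), |M.regret φ θ| ≤ C := by
  refine ⟨∑ θ, |M.optUtility θ| + M.horizon, fun φ θ => (abs_sub _ _).trans ?_⟩
  gcongr
  · exact Finset.single_le_sum (f := fun θ => |M.optUtility θ|) (fun _ _ => abs_nonneg _)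
      (Finset.mem_univ θ)
  · rw [M.utility_eq_sum hr]
    refine (Finset.abs_sum_le_sum_abs _ _).trans ((Finset.sum_le_sum fun t _ =>
      abs_le_one_of_mem_Icc (M.stepUtility_mem_Icc hr φ t θ)).trans ?_)
    simp

theorem stepUtility_stationary [DiscreteMeasurableSpace S] [DiscreteMeasurableSpace A]
    [Countable S] [Countable A] (hM : M.IsContextualBandit)
    (hr : ∀ y a, M.reward y a ∈ Set.Icc (0 : ℝ) 1) (s₀ : S) (a₀ : A) (f : S × O → A) (t : ℕ)
    (θ : O) (hf : Measurable fun s => f (s, θ)) :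
    M.stepUtility (Policy.stationary (fun s => f (s, θ)) hf).toRand t θ
      = ∫ x, M.ruleReward f θ x ∂(M.obsLaw s₀ a₀ t θ) := by
  have hm : Measurable fun z : Hist S A Y t × S => M.meanReward z.2 θ (f (z.2, θ)) :=
    M.measurable_meanReward_comp θ measurable_snd (hf.comp measurable_snd)
  have hstep : M.stepUtility (Policy.stationary (fun s => f (s, θ)) hf).toRand t θ
      = ∫ z, M.meanReward z.2 θ (f (z.2, θ))
          ∂(M.law (Policy.stationary (fun s => f (s, θ)) hf).toRand t θ) := by
    refine integral_congr_ae (ae_of_all _ fun z => ?_)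
    simp only [Policy.toRand, Kernel.deterministic_apply, integral_dirac]
    rfl
  rw [M.integral_ruleReward hr, hstep, M.law_eq_prod hM s₀ a₀ _ t θ,
    integral_prod _ (integrable_of_abs_le hm fun z => M.abs_meanReward_le hr _ _ _)]
  simp

/-- The optimum for each parameter is attained because there are finitely many maps `S → A`; gluing
these maximizers over the parameters gives a competitor to the rule `f`. -/
theorem sum_optUtility_le [DiscreteMeasurableSpace S] [DiscreteMeasurableSpace O] [Finite S]
    [Fintype O] [Finite A] [Nonempty A] (P : Measure O) [IsProbabilityMeasure P] {f : S × O → A}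
    (hf : M.IsOptimalRule P f) :
    ∑ θ, P.real {θ} * M.optUtility θ ≤ ∑ θ, P.real {θ} *
      M.utility (Policy.stationary (fun s => f (s, θ)) .of_discrete).toRand θ := by
  obtain ⟨hfm, hmax⟩ := hf
  have : Nonempty {f : S → A // Measurable f} := ⟨⟨fun _ => Classical.arbitrary A, .of_discrete⟩⟩
  have h : ∀ θ, ∃ g : {f : S → A // Measurable f},
      M.utility (Policy.stationary g.1 g.2).toRand θ = M.optUtility θ := fun θ =>
    exists_eq_ciSup_of_finite
  choose g hg using h
  have := hmax (fun p => (g p.2).1 p.1) .of_discrete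
  rw [M.oracleUtility_eq, M.oracleUtility_eq] at this
  simpa only [hg] using this

theorem minBayesRegret_le [DiscreteMeasurableSpace S] [DiscreteMeasurableSpace A]
    [Countable S] [Countable A] [Fintype O] (hr : ∀ y a, M.reward y a ∈ Set.Icc (0 : ℝ) 1) (P : Measure O)
    [IsProbabilityMeasure P] (π : Policy S A Y) :
    M.minBayesRegret P ≤ M.bayesRegret π.toRand P := by
  obtain ⟨C, hC⟩ := M.exists_abs_regret_le hr
  exact ciInf_le ⟨-C, by
    rintro _ ⟨π, rfl⟩
    exact (abs_le.1 (abs_integral_le fun θ => hC π.toRand θ)).1⟩ π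

end MDP
end
end MinimaxRL

/-! ### Posterior means and the exponential supermartingale -/

namespace MinimaxRL

noncomputable section

namespace MDP

variable {S A O Y : Type*} [MeasurableSpace S] [MeasurableSpace A] [MeasurableSpace O]
  [MeasurableSpace Y] [DiscreteMeasurableSpace O] [Fintype O] [Nonempty O] (M : MDP S A O Y)

/-- The posterior mean, given the history at time `t`, of a function of the state and the outcome
at time `t`. -/
def posteriorMean (s₀ : S) (a₀ : A) (P : Measure O) [IsProbabilityMeasure P]
    (φ : RandPolicy S A Y) (g : S × Y → ℝ) (t : ℕ) (h : Hist S A Y t) : ℝ :=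
  ∑ θ, (posterior (M.law φ t).fst P h).real {θ} * ∫ x, g x ∂(M.obsLaw s₀ a₀ t θ)

theorem measurable_posteriorMean (s₀ : S) (a₀ : A) (P : Measure O) [IsProbabilityMeasure P]
    (φ : RandPolicy S A Y) (g : S × Y → ℝ) (t : ℕ) :
    Measurable (M.posteriorMean s₀ a₀ P φ g t) :=
  Finset.measurable_sum _ fun θ _ => (measurable_posterior_real P _ θ).mul_const _

theorem abs_posteriorMean_le (s₀ : S) (a₀ : A) (P : Measure O) [IsProbabilityMeasure P]
    (φ : RandPolicy S A Y) {g : S × Y → ℝ} (h01 : ∀ x, g x ∈ Set.Icc (0 : ℝ) 1) (t : ℕ)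
    (h : Hist S A Y t) : |M.posteriorMean s₀ a₀ P φ g t h| ≤ 1 :=
  abs_average_le _ fun _ => abs_integral_le fun x => abs_le_one_of_mem_Icc (h01 x)

/-- An exponential supermartingale, under the Bayesian law of the history, that measures the
deviation of the rewards `g` from their posterior means. -/
theorem exists_exp_supermartingale (hM : M.IsContextualBandit) (s₀ : S) (a₀ : A) (P : Measure O)
    [IsProbabilityMeasure P] (φ : RandPolicy S A Y) {g : S × Y → ℝ} (hg : Measurable g)
    (h01 : ∀ x, g x ∈ Set.Icc (0 : ℝ) 1) (η : ℝ) (t : ℕ) :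
    ∃ L : Hist S A Y t → ℝ, Measurable L ∧ (∃ C, ∀ h, |L h| ≤ C) ∧
      ∫ h, Real.exp (L h) ∂(P.bind (M.law φ t).fst) ≤ 1 ∧
      ∀ θ, ∫ h, L h ∂((M.law φ t).fst θ) = ∑ i ∈ Finset.range t,
        (η * (∫ x, g x ∂(M.obsLaw s₀ a₀ i θ)
          - ∫ h, M.posteriorMean s₀ a₀ P φ g i h ∂((M.law φ i).fst θ)) - η ^ 2 / 8) := by
  induction t with
  | zero => exact ⟨fun _ => 0, measurable_const, ⟨0, by simp⟩, by simp, by simp⟩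
  | succ t ih =>
    obtain ⟨L, hL, ⟨C, hC⟩, hexp, hint⟩ := ih
    set m := M.posteriorMean s₀ a₀ P φ g t with hm
    have hmm : Measurable m := M.measurable_posteriorMean s₀ a₀ P φ g t
    have hm1 : ∀ h, |m h| ≤ 1 := M.abs_posteriorMean_le s₀ a₀ P φ h01 t
    have hg1 : ∀ x, |g x| ≤ 1 := fun x => abs_le_one_of_mem_Icc (h01 x)
    -- The new increment, with `η² / 8` subtracted to absorb the Hoeffding bound.
    let G : Hist S A Y t → S × Y → ℝ := fun h x => L h + η * (g x - m h) - η ^ 2 / 8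
    have hG : Measurable (fun z : Hist S A Y t × (S × Y) => G z.1 z.2) := by
      simp only [G]; fun_prop
    have hGC : ∀ h x, |G h x| ≤ C + |η| * 2 + η ^ 2 / 8 := fun h x => by
      have h1 : |η * (g x - m h)| ≤ |η| * 2 := by
        rw [abs_mul]
        gcongr
        calc |g x - m h| ≤ |g x| + |m h| := abs_sub _ _
          _ ≤ 2 := by linarith [hg1 x, hm1 h]
      have h2 : |η ^ 2 / 8| = η ^ 2 / 8 := abs_of_nonneg (by positivity)
      calc |G h x| ≤ |L h + η * (g x - m h)| + |η ^ 2 / 8| := abs_sub _ _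
        _ ≤ |L h| + |η * (g x - m h)| + |η ^ 2 / 8| := by gcongr; exact abs_add_le _ _
        _ ≤ _ := by rw [h2]; linarith [hC h]
    have hexpG : ∀ h x, |Real.exp (G h x)| ≤ Real.exp (C + |η| * 2 + η ^ 2 / 8) := fun h x => by
      rw [abs_of_pos (Real.exp_pos _)]
      exact Real.exp_le_exp.2 ((le_abs_self _).trans (hGC h x))
    have hproj : Measurable (fun h : Hist S A Y (t + 1) =>
        ((fun i => h i.castSucc : Hist S A Y t), ((h (Fin.last t)).1, (h (Fin.last t)).2.2))) := by
      fun_prop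
    refine ⟨fun h => G (fun i => h i.castSucc) ((h (Fin.last t)).1, (h (Fin.last t)).2.2),
      hG.comp hproj, ⟨_, fun h => hGC _ _⟩, ?_, fun θ => ?_⟩
    · have hexpm : Measurable (fun h : Hist S A Y (t + 1) => Real.exp
          (G (fun i => h i.castSucc) ((h (Fin.last t)).1, (h (Fin.last t)).2.2))) :=
        (hG.comp hproj).exp
      rw [integral_bind_eq_sum P _ hexpm fun h => hexpG _ _]
      simp only [M.integral_fst_law_succ_obs hM s₀ a₀ φ t _ hG.exp hexpG]
      have hinner : ∀ θ, Measurable (fun h => ∫ x, Real.exp (G h x) ∂(M.obsLaw s₀ a₀ t θ)) :=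
        fun θ => (hG.exp.stronglyMeasurable.integral_prod_right').measurable
      -- Bayes' formula turns the mixture over the prior into a posterior average given the history.
      -- Hoeffding's lemma then applies with the posterior predictive law, whose mean is `m h`.
      rw [sum_integral_eq_integral_posterior P _ hinner fun θ h => abs_integral_le (hexpG h)]
      refine (integral_mono ?_ ?_ fun h => ?_).trans hexp
      · refine integrable_of_abs_le (Finset.measurable_sum _ fun θ _ =>
          (measurable_posterior_real P _ θ).mul (hinner θ)) fun h =>
          abs_average_le _ fun θ => abs_integral_le (hexpG h)
      · refine integrable_of_abs_le hL.exp (C := Real.exp C) fun h => ?_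
        rw [abs_of_pos (Real.exp_pos _)]
        exact Real.exp_le_exp.2 ((le_abs_self _).trans (hC h))
      · have e : ∀ θ, ∫ x, Real.exp (G h x) ∂(M.obsLaw s₀ a₀ t θ)
            = Real.exp (L h - η * m h - η ^ 2 / 8) *
              ∫ x, Real.exp (η * g x) ∂(M.obsLaw s₀ a₀ t θ) := fun θ => by
          rw [← integral_const_mul]
          congr 1; ext x
          rw [← Real.exp_add]
          congr 1
          simp only [G]; ring
        have hoeff := sum_integral_exp_le (posterior (M.law φ t).fst P h) (M.obsLaw s₀ a₀ t)
          hg h01 η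
        simp only [e]
        calc ∑ θ, (posterior (M.law φ t).fst P h).real {θ} *
              (Real.exp (L h - η * m h - η ^ 2 / 8) *
                ∫ x, Real.exp (η * g x) ∂(M.obsLaw s₀ a₀ t θ))
            = Real.exp (L h - η * m h - η ^ 2 / 8) *
              ∑ θ, (posterior (M.law φ t).fst P h).real {θ} *
                ∫ x, Real.exp (η * g x) ∂(M.obsLaw s₀ a₀ t θ) := by
              rw [Finset.mul_sum]
              exact Finset.sum_congr rfl fun θ _ => by ring
          _ ≤ Real.exp (L h - η * m h - η ^ 2 / 8) * Real.exp (η * m h + η ^ 2 / 8) := by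
              gcongr
              exact hoeff
          _ = Real.exp (L h) := by
              rw [← Real.exp_add]; congr 1; ring
    · rw [M.integral_fst_law_succ_obs hM s₀ a₀ φ t θ hG hGC, Finset.sum_range_succ, ← hint θ]
      have hgi : Integrable g (M.obsLaw s₀ a₀ t θ) := integrable_of_abs_le hg hg1
      have e : ∀ h, ∫ x, G h x ∂(M.obsLaw s₀ a₀ t θ)
          = L h + η * (∫ x, g x ∂(M.obsLaw s₀ a₀ t θ) - m h) - η ^ 2 / 8 := fun h => by
        simp only [G]
        rw [integral_sub (by fun_prop) (by fun_prop), integral_add (by fun_prop) (by fun_prop),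
          integral_const_mul, integral_sub hgi (by fun_prop)]
        simp
      have hLi : Integrable L ((M.law φ t).fst θ) := integrable_of_abs_le hL hC
      have hmi : Integrable m ((M.law φ t).fst θ) := integrable_of_abs_le hmm hm1
      simp only [e]
      rw [integral_sub (by fun_prop) (by fun_prop), integral_add hLi (by fun_prop),
        integral_const_mul, integral_sub (by fun_prop) hmi]
      simp only [integral_const, probReal_univ, one_smul]
      ring

/-- The cumulative excess of the rewards `g` under the parameter `θ` over their posterior means is
controlled by the prior mass of `θ`. -/
theorem mul_sum_sub_posteriorMean_le (hM : M.IsContextualBandit) (s₀ : S) (a₀ : A)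
    (P : Measure O) [IsProbabilityMeasure P] (φ : RandPolicy S A Y) {g : S × Y → ℝ}
    (hg : Measurable g) (h01 : ∀ x, g x ∈ Set.Icc (0 : ℝ) 1) (η : ℝ) (n : ℕ) {θ : O}
    (hθ : 0 < P.real {θ}) :
    η * ∑ i ∈ Finset.range n, (∫ x, g x ∂(M.obsLaw s₀ a₀ i θ)
          - ∫ h, M.posteriorMean s₀ a₀ P φ g i h ∂((M.law φ i).fst θ))
      ≤ -Real.log (P.real {θ}) + n * (η ^ 2 / 8) := by
  obtain ⟨L, hL, ⟨C, hC⟩, hexp, hint⟩ :=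
    M.exists_exp_supermartingale hM s₀ a₀ P φ hg h01 η n
  have h1 := hint θ
  rw [Finset.sum_sub_distrib, ← Finset.mul_sum] at h1
  simp only [Finset.sum_const, Finset.card_range, nsmul_eq_mul] at h1
  have hexpC : ∀ h, |Real.exp (L h)| ≤ Real.exp C := fun h => by
    rw [abs_of_pos (Real.exp_pos _)]
    exact Real.exp_le_exp.2 ((le_abs_self _).trans (hC h))
  have hei : Integrable (fun h => Real.exp (L h)) ((M.law φ n).fst θ) :=
    integrable_of_abs_le hL.exp hexpC
  have hLi : Integrable L ((M.law φ n).fst θ) := integrable_of_abs_le hL hC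
  rw [integral_bind_eq_sum P _ hL.exp hexpC] at hexp
  -- Change of measure: only the term of `θ` is kept from the mixture.
  have h2 : P.real {θ} * ∫ h, Real.exp (L h) ∂((M.law φ n).fst θ) ≤ 1 :=
    (Finset.single_le_sum (f := fun θ => P.real {θ} *
      ∫ h, Real.exp (L h) ∂((M.law φ n).fst θ)) (fun θ _ => mul_nonneg measureReal_nonneg
        (integral_nonneg fun h => (Real.exp_pos _).le)) (Finset.mem_univ θ)).trans hexp
  -- The inequality `x + 1 ≤ exp x` replaces Jensen; with `h2` the ones cancel.
  have h3 : ∫ h, (L h + Real.log (P.real {θ}) + 1) ∂((M.law φ n).fst θ)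
      ≤ ∫ h, P.real {θ} * Real.exp (L h) ∂((M.law φ n).fst θ) := by
    refine integral_mono (by fun_prop) (by fun_prop) fun h => ?_
    calc L h + Real.log (P.real {θ}) + 1 ≤ Real.exp (L h + Real.log (P.real {θ})) :=
          Real.add_one_le_exp _
      _ = P.real {θ} * Real.exp (L h) := by rw [Real.exp_add, Real.exp_log hθ, mul_comm]
  rw [integral_const_mul, integral_add (by fun_prop) (by fun_prop),
    integral_add hLi (by fun_prop)] at h3
  simp only [integral_const, probReal_univ, one_smul] at h3
  linarith

/-- The function `g` may vary with `θ`, since the preceding bound holds for each `θ` separately;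
averaging `-log P(θ)` gives the entropy, and parameters of zero mass contribute nothing. -/
theorem sum_ruleReward_sub_posteriorMean_le [DiscreteMeasurableSpace S]
    (hM : M.IsContextualBandit) (hr : ∀ y a, M.reward y a ∈ Set.Icc (0 : ℝ) 1) (s₀ : S) (a₀ : A)
    (P : Measure O) [IsProbabilityMeasure P] (φ : RandPolicy S A Y) (f : S × O → A) (n : ℕ) :
    ∑ θ, P.real {θ} * ∑ i ∈ Finset.range n, (∫ x, M.ruleReward f θ x ∂(M.obsLaw s₀ a₀ i θ)
        - ∫ h, M.posteriorMean s₀ a₀ P φ (M.ruleReward f θ) i h ∂((M.law φ i).fst θ))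
      ≤ √(n * entropy P / 2) := by
  have hH : 0 ≤ entropy P :=
    Finset.sum_nonneg fun θ _ => Real.negMulLog_nonneg measureReal_nonneg measureReal_le_one
  refine le_sqrt_of_forall_mul_le (Nat.cast_nonneg n) hH fun η _ => ?_
  rw [Finset.mul_sum]
  calc _ ≤ ∑ θ, (Real.negMulLog (P.real {θ}) + P.real {θ} * (n * (η ^ 2 / 8))) := by
        refine Finset.sum_le_sum fun θ _ => ?_
        rcases (measureReal_nonneg (μ := P) (s := {θ})).eq_or_lt with h | h
        · simp [← h]
        · have := M.mul_sum_sub_posteriorMean_le hM s₀ a₀ P φ (M.measurable_ruleReward f θ)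
            (fun x => hr _ _) η n h
          have := mul_le_mul_of_nonneg_left this h.le
          rw [Real.negMulLog]
          linarith
    _ = entropy P + n * (η ^ 2 / 8) := by
        rw [Finset.sum_add_distrib, ← Finset.sum_mul, sum_measureReal_singleton, one_mul]
        rfl

theorem integral_thompsonAct [DiscreteMeasurableSpace S] [DiscreteMeasurableSpace A] [Finite S]
    (P : Measure O) [IsProbabilityMeasure P] (f : S × O → A) {t : ℕ}
    (κ : Kernel O (Hist S A Y t × S)) [IsMarkovKernel κ] (z : Hist S A Y t × S) (v : A → ℝ) :
    ∫ a, v a ∂(thompsonAct P f κ z) = ∑ θ, (posterior κ.fst P z.1).real {θ} * v (f (z.2, θ)) := by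
  have hf : Measurable fun w : O × S => f (w.2, w.1) := .of_discrete
  rw [thompsonAct, Kernel.map_apply _ hf, integral_map hf.aemeasurable
    (Measurable.of_discrete (f := v)).aestronglyMeasurable, Kernel.prod_apply,
    integral_prod _ .of_finite]
  simp only [Kernel.comap_apply, Kernel.deterministic_apply, integral_dirac, integral_eq_sum]

/-- Expected reward of the rule `f` for a parameter drawn from the posterior given the history. -/
def sampledReward (P : Measure O) [IsProbabilityMeasure P] (φ : RandPolicy S A Y)
    (f : S × O → A) (t : ℕ) (θ : O) (z : Hist S A Y t × S) : ℝ :=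
  ∑ θ', (posterior (M.law φ t).fst P z.1).real {θ'} * M.meanReward z.2 θ (f (z.2, θ'))

theorem abs_sampledReward_le (hr : ∀ y a, M.reward y a ∈ Set.Icc (0 : ℝ) 1) (P : Measure O)
    [IsProbabilityMeasure P] (φ : RandPolicy S A Y)
    (f : S × O → A) (t : ℕ) (θ : O) (z : Hist S A Y t × S) : |M.sampledReward P φ f t θ z| ≤ 1 :=
  abs_average_le _ fun _ => M.abs_meanReward_le hr _ _ _

theorem stepUtility_thompson [DiscreteMeasurableSpace S] [DiscreteMeasurableSpace A]
    [Finite S] (P : Measure O) [IsProbabilityMeasure P] (f : S × O → A)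
    (hf : Measurable f) (t : ℕ) (θ : O) :
    M.stepUtility (M.thompson P f hf) t θ
      = ∫ z, M.sampledReward P (M.thompson P f hf) f t θ z ∂(M.law (M.thompson P f hf) t θ) := by
  refine integral_congr_ae (ae_of_all _ fun z => ?_)
  have hκ := M.law_thompson P f hf t
  have : IsMarkovKernel (M.thompsonLaw P f hf t).1 := (M.thompsonLaw P f hf t).2
  change ∫ a, M.meanReward z.2 θ a ∂(thompsonAct P f (M.thompsonLaw P f hf t).1 z) = _
  rw [integral_thompsonAct]
  simp only [sampledReward, hκ]

end MDP
end
end MinimaxRL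

/-! ### Exchangeability and the Bayesian regret bound -/

namespace MinimaxRL

noncomputable section

namespace MDP

variable {S A O Y : Type*} [MeasurableSpace S] [MeasurableSpace A] [MeasurableSpace O]
  [MeasurableSpace Y] [DiscreteMeasurableSpace S] [DiscreteMeasurableSpace A]
  [DiscreteMeasurableSpace O] [Finite S] [Fintype A] [Fintype O] [Nonempty O] (M : MDP S A O Y)

theorem measurable_sampledReward (P : Measure O) [IsProbabilityMeasure P] (φ : RandPolicy S A Y)
    (f : S × O → A) (t : ℕ) (θ : O) : Measurable (M.sampledReward P φ f t θ) :=
  Finset.measurable_sum _ fun θ' _ => ((measurable_posterior_real P _ θ').comp measurable_fst).mul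
    (M.measurable_meanReward_comp θ measurable_snd
      ((Measurable.of_discrete (f := fun s => f (s, θ'))).comp measurable_snd))

/-- Exchangeability of the true parameter and of a posterior sample given the history. -/
theorem sum_integral_posteriorMean (hM : M.IsContextualBandit)
    (hr : ∀ y a, M.reward y a ∈ Set.Icc (0 : ℝ) 1) (s₀ : S) (a₀ : A)
    (P : Measure O) [IsProbabilityMeasure P] (φ : RandPolicy S A Y) (f : S × O → A) (t : ℕ) :
    ∑ θ, P.real {θ} *
        ∫ h, M.posteriorMean s₀ a₀ P φ (M.ruleReward f θ) t h ∂((M.law φ t).fst θ)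
      = ∑ θ, P.real {θ} * ∫ z, M.sampledReward P φ f t θ z ∂(M.law φ t θ) := by
  have hint : ∀ θ, ∫ z, M.sampledReward P φ f t θ z ∂(M.law φ t θ)
      = ∫ h, ∑ θ', (posterior (M.law φ t).fst P h).real {θ'} *
          ∫ x, M.ruleReward f θ' x ∂(M.obsLaw s₀ a₀ t θ) ∂((M.law φ t).fst θ) := fun θ => by
    rw [M.law_eq_prod hM s₀ a₀ φ t θ, integral_prod _ (integrable_of_abs_le
      (M.measurable_sampledReward P φ f t θ) (M.abs_sampledReward_le hr P φ f t θ))]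
    refine integral_congr_ae (ae_of_all _ fun h => ?_)
    simp only [sampledReward]
    rw [integral_finsetSum _ fun θ' _ => .of_finite]
    refine Finset.sum_congr rfl fun θ' _ => ?_
    rw [integral_const_mul, M.integral_ruleReward hr]
  have hrule : ∀ θ θ', |∫ x, M.ruleReward f θ' x ∂(M.obsLaw s₀ a₀ t θ)| ≤ 1 := fun θ θ' =>
    abs_integral_le fun x => abs_le_one_of_mem_Icc (hr _ _)
  simp only [hint]
  rw [sum_integral_eq_integral_posterior P _
      (fun θ => M.measurable_posteriorMean s₀ a₀ P φ (M.ruleReward f θ) t)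
      (fun θ => M.abs_posteriorMean_le s₀ a₀ P φ (g := M.ruleReward f θ) (fun x => hr _ _) t),
    sum_integral_eq_integral_posterior P _ (fun θ => Finset.measurable_sum _ fun θ' _ =>
      (measurable_posterior_real P _ θ').mul_const _) fun θ h => abs_average_le _ (hrule θ)]
  refine integral_congr_ae (ae_of_all _ fun h => ?_)
  simp only [posteriorMean, Finset.mul_sum]
  rw [Finset.sum_comm]
  exact Finset.sum_congr rfl fun θ _ => Finset.sum_congr rfl fun θ' _ => by ring

/-- Isolates what an algorithm must satisfy: at each step it earns on average at least what a
posterior sample would, the posterior being that of its own history. Thompson sampling and the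
greedy policy both qualify. -/
theorem bayesRegret_le_of_sampledReward_le [Nonempty A] (hM : M.IsContextualBandit)
    (hr : ∀ y a, M.reward y a ∈ Set.Icc (0 : ℝ) 1) (s₀ : S)
    (P : Measure O) [IsProbabilityMeasure P] {f : S × O → A} (hf : M.IsOptimalRule P f)
    (φ : RandPolicy S A Y)
    (hφ : ∀ t, ∑ θ, P.real {θ} * ∫ z, M.sampledReward P φ f t θ z ∂(M.law φ t θ)
      ≤ ∑ θ, P.real {θ} * M.stepUtility φ t θ) :
    M.bayesRegret φ P ≤ √(M.horizon * entropy P / 2) := by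
  have a₀ : A := Classical.arbitrary A
  refine le_trans ?_ (M.sum_ruleReward_sub_posteriorMean_le hM hr s₀ a₀ P φ f M.horizon)
  have h1 := M.sum_optUtility_le P hf
  simp only [M.utility_eq_sum hr, M.stepUtility_stationary hM hr s₀ a₀] at h1
  -- By exchangeability the averaged posterior means are sampled rewards, which `hφ` compares with
  -- the rewards of `φ`.
  have h2 : ∑ θ, P.real {θ} * ∑ t ∈ Finset.range M.horizon,
        ∫ h, M.posteriorMean s₀ a₀ P φ (M.ruleReward f θ) t h ∂((M.law φ t).fst θ)
      ≤ ∑ θ, P.real {θ} * M.utility φ θ := by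
    simp only [M.utility_eq_sum hr, Finset.mul_sum]
    rw [Finset.sum_comm, Finset.sum_comm (s := Finset.univ)]
    refine Finset.sum_le_sum fun t _ => ?_
    rw [M.sum_integral_posteriorMean hM hr]
    exact hφ t
  simp only [bayesRegret, regret]
  rw [integral_eq_sum]
  simp only [Finset.sum_sub_distrib, mul_sub]
  linarith

/-! ### The greedy policy -/

section Greedy

variable [Nonempty A]

/-- An action that maximizes the posterior expected reward given the history and the state, when
`κ θ` is their law given `θ`. -/
theorem exists_greedyAct (P : Measure O) [IsProbabilityMeasure P] {t : ℕ}
    (κ : Kernel O (Hist S A Y t × S)) [IsMarkovKernel κ] :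
    ∃ g : Hist S A Y t × S → A, Measurable g ∧ ∀ z a,
      ∑ θ, (posterior κ P z).real {θ} * M.meanReward z.2 θ a
        ≤ ∑ θ, (posterior κ P z).real {θ} * M.meanReward z.2 θ (g z) :=
  exists_measurable_argmax fun _ => Finset.measurable_sum _ fun θ _ =>
    (measurable_posterior_real P κ θ).mul
      (M.measurable_meanReward_comp θ measurable_snd measurable_const)

/-- The law of (history, current state) under the policy that maximizes the posterior expected
reward at each time. -/
def greedyLaw (P : Measure O) [IsProbabilityMeasure P] :
    ∀ t : ℕ, {κ : Kernel O (Hist S A Y t × S) // IsMarkovKernel κ}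
  | 0 => ⟨M.start, inferInstance⟩
  | t + 1 =>
    let κ := greedyLaw P t
    haveI := κ.2
    ⟨M.step κ.1 (Kernel.deterministic _ (M.exists_greedyAct P κ.1).choose_spec.1), inferInstance⟩

/-- The policy that maximizes the posterior expected reward at each time. -/
def greedy (P : Measure O) [IsProbabilityMeasure P] : Policy S A Y where
  act t := haveI := (M.greedyLaw P t).2; (M.exists_greedyAct P (M.greedyLaw P t).1).choose
  measurable_act t := haveI := (M.greedyLaw P t).2
    (M.exists_greedyAct P (M.greedyLaw P t).1).choose_spec.1

/-- The greedy action at time `t` needs the posterior under the law created by the earlier choices,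
so law and actions are built together; this identifies that law with the one the finished policy
generates. -/
theorem law_greedy (P : Measure O) [IsProbabilityMeasure P] (t : ℕ) :
    M.law (M.greedy P).toRand t = (M.greedyLaw P t).1 := by
  induction t with
  | zero => rfl
  | succ t ih =>
    change M.step (M.law (M.greedy P).toRand t) _ = _
    rw [ih]
    rfl

theorem posterior_le_greedy (P : Measure O) [IsProbabilityMeasure P] (t : ℕ)
    (z : Hist S A Y t × S) (a : A) :
    ∑ θ, (posterior (M.law (M.greedy P).toRand t) P z).real {θ} * M.meanReward z.2 θ a
      ≤ ∑ θ, (posterior (M.law (M.greedy P).toRand t) P z).real {θ} *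
          M.meanReward z.2 θ ((M.greedy P).act t z) := by
  have : IsMarkovKernel (M.greedyLaw P t).1 := (M.greedyLaw P t).2
  have h := (M.exists_greedyAct P (M.greedyLaw P t).1).choose_spec.2 z a
  simp only [M.law_greedy P t]
  exact h

/-- Given history and state, the sampled parameter is independent of the true one, so sampling earns
an average of the posterior values of fixed actions, each at most the greedy value. The sampling
weights see the history only, whereas the greedy posterior also uses the state. -/
theorem sampledReward_le_stepUtility_greedy (hr : ∀ y a, M.reward y a ∈ Set.Icc (0 : ℝ) 1)
    (P : Measure O) [IsProbabilityMeasure P] (f : S × O → A) (t : ℕ) :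
    ∑ θ, P.real {θ} * ∫ z, M.sampledReward P (M.greedy P).toRand f t θ z
        ∂(M.law (M.greedy P).toRand t θ)
      ≤ ∑ θ, P.real {θ} * M.stepUtility (M.greedy P).toRand t θ := by
  have hstep : ∀ θ, M.stepUtility (M.greedy P).toRand t θ
      = ∫ z, M.meanReward z.2 θ ((M.greedy P).act t z) ∂(M.law (M.greedy P).toRand t θ) :=
    fun θ => by
      refine integral_congr_ae (ae_of_all _ fun z => ?_)
      simp only [Policy.toRand, Kernel.deterministic_apply, integral_dirac]
  have hg : ∀ θ, Measurable fun z => M.meanReward z.2 θ ((M.greedy P).act t z) := fun θ =>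
    M.measurable_meanReward_comp θ measurable_snd ((M.greedy P).measurable_act t)
  simp only [hstep]
  set φ := (M.greedy P).toRand
  have hsm := M.measurable_sampledReward P φ f t
  have hsb := M.abs_sampledReward_le hr P φ f t
  rw [sum_integral_eq_integral_posterior P _ hsm hsb,
    sum_integral_eq_integral_posterior P _ hg fun θ z => M.abs_meanReward_le hr _ _ _]
  refine integral_mono (integrable_of_abs_le (Finset.measurable_sum _ fun θ _ =>
      (measurable_posterior_real P _ θ).mul (hsm θ)) fun z => abs_average_le _ fun θ => hsb θ z)
    (integrable_of_abs_le (Finset.measurable_sum _ fun θ _ =>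
      (measurable_posterior_real P _ θ).mul (hg θ)) fun z =>
      abs_average_le _ fun θ => M.abs_meanReward_le hr _ _ _) fun z => ?_
  set V := ∑ θ, (posterior (M.law φ t) P z).real {θ} * M.meanReward z.2 θ ((M.greedy P).act t z)
    with hV
  calc ∑ θ, (posterior (M.law φ t) P z).real {θ} * M.sampledReward P φ f t θ z
      = ∑ θ', (posterior (M.law φ t).fst P z.1).real {θ'} *
          ∑ θ, (posterior (M.law φ t) P z).real {θ} * M.meanReward z.2 θ (f (z.2, θ')) := by
        simp only [sampledReward, Finset.mul_sum]
        rw [Finset.sum_comm]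
        exact Finset.sum_congr rfl fun θ _ => Finset.sum_congr rfl fun θ' _ => by ring
    _ ≤ ∑ θ', (posterior (M.law φ t).fst P z.1).real {θ'} * V := by
        gcongr
        exact M.posterior_le_greedy P t z _
    _ = V := by rw [← Finset.sum_mul, sum_measureReal_singleton, one_mul]

end Greedy

/-! ### Minimax duality by separation -/

section Minimax

variable [Nonempty A]

instance : Nonempty (Policy S A Y) :=
  ⟨Policy.stationary (fun _ => Classical.arbitrary A) measurable_const⟩

/-- The minimax regret is at most the worst-case minimum Bayesian regret. -/
theorem minimaxRegret_le (hr : ∀ y a, M.reward y a ∈ Set.Icc (0 : ℝ) 1) {B : ℝ}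
    (hB : ∀ (P : Measure O) [IsProbabilityMeasure P], M.minBayesRegret P ≤ B) :
    M.minimaxRegret ≤ B := by
  classical
  obtain ⟨C, hC⟩ := M.exists_abs_regret_le hr
  have hmeas : ∀ θ, Measurable fun π : Policy S A Y => M.regret π.toRand θ := fun θ =>
    measurable_from_top
  have hint : ∀ θ (μ : Measure (Policy S A Y)) [IsFiniteMeasure μ],
      Integrable (fun π : Policy S A Y => M.regret π.toRand θ) μ := fun θ μ _ =>
    integrable_of_abs_le (hmeas θ) fun π => hC _ θ
  have hbound : ∀ (Q : ProbabilityMeasure (Policy S A Y)) θ,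
      |∫ π, M.regret π.toRand θ ∂(Q : Measure (Policy S A Y))| ≤ C := fun Q θ =>
    abs_integral_le fun π => hC _ θ
  refine le_of_forall_gt_imp_ge_of_dense fun v hv => ?_
  -- The vectors strictly above the risk vector of some randomized policy. If the constant `v > B`
  -- lies in `K`, the minimax regret is at most `v`; otherwise separation yields a prior that
  -- contradicts `hB`.
  let K : Set (O → ℝ) := {x | ∃ Q : ProbabilityMeasure (Policy S A Y), ∀ θ,
    ∫ π, M.regret π.toRand θ ∂(Q : Measure (Policy S A Y)) < x θ}
  by_cases hvK : (fun _ => v) ∈ K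
  · obtain ⟨Q, hQ⟩ := hvK
    refine (ciInf_le ⟨-C, ?_⟩ Q).trans (ciSup_le fun θ => (hQ θ).le)
    rintro _ ⟨Q', rfl⟩
    exact (abs_le.1 (hbound Q' (Classical.arbitrary O))).1.trans
      (le_ciSup (f := fun θ => ∫ π, M.regret π.toRand θ ∂(Q' : Measure (Policy S A Y)))
        (Set.finite_range _).bddAbove _)
  exfalso
  have hopen : IsOpen K := by
    have : K = ⋃ Q : ProbabilityMeasure (Policy S A Y), ⋂ θ, {x : O → ℝ |
        ∫ π, M.regret π.toRand θ ∂(Q : Measure (Policy S A Y)) < x θ} := by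
      ext x; simp [K]
    rw [this]
    exact isOpen_iUnion fun Q => isOpen_iInter_of_finite fun θ =>
      isOpen_lt continuous_const (continuous_apply θ)
  have hconv : Convex ℝ K := by
    rintro x ⟨Q, hQ⟩ x' ⟨Q', hQ'⟩ a b ha hb hab
    let μ : Measure (Policy S A Y) := ENNReal.ofReal a • (Q : Measure (Policy S A Y)) +
      ENNReal.ofReal b • (Q' : Measure (Policy S A Y))
    have hμ : IsProbabilityMeasure μ := ⟨by
      simp [μ, ← ENNReal.ofReal_add ha hb, hab]⟩
    refine ⟨⟨μ, hμ⟩, fun θ => ?_⟩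
    have e : ∫ π, M.regret π.toRand θ ∂μ = a * ∫ π, M.regret π.toRand θ ∂(Q : Measure (Policy S A Y))
        + b * ∫ π, M.regret π.toRand θ ∂(Q' : Measure (Policy S A Y)) := by
      rw [integral_add_measure ((hint θ _).smul_measure ENNReal.ofReal_ne_top)
        ((hint θ _).smul_measure ENNReal.ofReal_ne_top), integral_smul_measure,
        integral_smul_measure, ENNReal.toReal_ofReal ha, ENNReal.toReal_ofReal hb]
      rfl
    change ∫ π, M.regret π.toRand θ ∂μ < a * x θ + b * x' θ
    rw [e]
    rcases ha.eq_or_lt with rfl | ha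
    · have : b = 1 := by linarith
      subst this
      linarith [hQ' θ]
    · have h1 := mul_lt_mul_of_pos_left (hQ θ) ha
      have h2 := mul_le_mul_of_nonneg_left (hQ' θ).le hb
      linarith
  obtain ⟨ℓ, hℓ⟩ := geometric_hahn_banach_open_point hconv hopen hvK
  -- The sign is chosen so that `w`, once normalized, is the sought prior.
  let w : O → ℝ := fun θ => -ℓ (Pi.single θ 1)
  have hℓw : ∀ x, ℓ x = -∑ θ, x θ * w θ := fun x => by
    conv_lhs => rw [pi_eq_sum_univ' x]
    rw [map_sum, ← Finset.sum_neg_distrib]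
    refine Finset.sum_congr rfl fun θ _ => ?_
    rw [map_smul, smul_eq_mul]
    simp only [w]
    ring
  have hdirac : ∀ (π : Policy S A Y) (x : O → ℝ), (∀ θ, M.regret π.toRand θ < x θ) → x ∈ K :=
    fun π x hx => ⟨⟨Measure.dirac π, inferInstance⟩, fun θ => by
      change ∫ π, M.regret π.toRand θ ∂(Measure.dirac π) < _
      rw [integral_dirac]
      exact hx θ⟩
  let π₀ : Policy S A Y := Classical.arbitrary _
  have hC1 : ∀ θ, M.regret π₀.toRand θ < C + 1 := fun θ =>
    (le_abs_self _).trans_lt ((hC _ θ).trans_lt (lt_add_one C))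
  have hw : ∀ θ, 0 ≤ w θ := fun θ => by
    by_contra! hneg
    set D := ℓ (fun _ => v) - ℓ (fun _ => C + 1) with hD
    have hDpos : 0 < D := sub_pos.2 (hℓ _ (hdirac π₀ _ hC1))
    -- If `w θ < 0`, raising coordinate `θ` stays in `K` and increases `ℓ`; this amount increases it
    -- by exactly `D`, up to the value at `v`, against strict separation.
    have hmem : (fun _ => C + 1) + Pi.single θ (D / -w θ) ∈ K := hdirac π₀ _ fun θ' => by
      have h0 : (0 : ℝ) ≤ Pi.single (M := fun _ => ℝ) θ (D / -w θ) θ' := by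
        rw [Pi.single_apply]
        split_ifs
        · exact div_nonneg hDpos.le (by linarith)
        · rfl
      simp only [Pi.add_apply]
      linarith [hC1 θ']
    have h1 := hℓ _ hmem
    rw [map_add, hℓw (Pi.single θ _)] at h1
    have h2 : ∑ θ', Pi.single (M := fun _ => ℝ) θ (D / -w θ) θ' * w θ' = -D := by
      rw [Finset.sum_eq_single θ (fun θ' _ h => by simp [h]) (by simp)]
      rw [Pi.single_eq_same, div_neg, neg_mul, div_mul_cancel₀ _ hneg.ne]
    linarith
  have hW : 0 < ∑ θ, w θ := by
    refine (Finset.sum_nonneg fun θ _ => hw θ).lt_of_ne fun h0 => ?_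
    have hz : ∀ θ, w θ = 0 := fun θ =>
      (Finset.sum_eq_zero_iff_of_nonneg fun θ _ => hw θ).1 h0.symm θ (Finset.mem_univ θ)
    have := hℓ _ (hdirac π₀ _ hC1)
    simp [hℓw, hz] at this
  obtain ⟨P, hP, hPw⟩ := exists_probabilityMeasure_real_singleton
    (p := fun θ => w θ / ∑ θ, w θ) (fun θ => div_nonneg (hw θ) hW.le)
    (by rw [← Finset.sum_div, div_self hW.ne'])
  -- The slack `(v - B) / 2 > 0` moves the regret vector strictly inside `K`; the separation then
  -- gives every policy a Bayesian regret above `v - (v - B) / 2`, which exceeds `B`.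
  have hlow : (v + B) / 2 ≤ M.minBayesRegret P := le_ciInf fun π => by
    have hx := hℓ _ (hdirac π (fun θ => M.regret π.toRand θ + (v - B) / 2)
      fun θ => by linarith)
    rw [hℓw, hℓw, neg_lt_neg_iff, ← Finset.mul_sum] at hx
    simp only [add_mul, Finset.sum_add_distrib, ← Finset.mul_sum] at hx
    rw [bayesRegret, integral_eq_sum]
    simp only [hPw, div_mul_eq_mul_div]
    rw [← Finset.sum_div, le_div_iff₀ hW]
    simp only [mul_comm (w _)]
    linarith
  linarith [hB P]

end Minimax

end MDP

/-- Gibbs' inequality against the uniform law: `log x ≤ x - 1` at `x = 1 / (N p)`, with corrections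
`N⁻¹ - p` that sum to zero. -/
theorem entropy_le_log_card {O : Type*} [MeasurableSpace O] [DiscreteMeasurableSpace O]
    [Fintype O] [Nonempty O] (P : Measure O) [IsProbabilityMeasure P] :
    entropy P ≤ Real.log (Fintype.card O) := by
  set N : ℝ := (Fintype.card O : ℝ) with hN
  have hNpos : 0 < N := by rw [hN]; exact_mod_cast Fintype.card_pos
  have h : ∀ θ, Real.negMulLog (P.real {θ})
      ≤ P.real {θ} * Real.log N + (N⁻¹ - P.real {θ}) := fun θ => by
    rcases (measureReal_nonneg (μ := P) (s := {θ})).eq_or_lt with h | h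
    · simp [← h, hNpos.le]
    · have h1 := Real.log_le_sub_one_of_pos (x := (N * P.real {θ})⁻¹) (by positivity)
      rw [Real.log_inv, Real.log_mul hNpos.ne' h.ne'] at h1
      have h2 := mul_le_mul_of_nonneg_left h1 h.le
      have h3 : P.real {θ} * ((N * P.real {θ})⁻¹ - 1) = N⁻¹ - P.real {θ} := by
        field_simp
      rw [Real.negMulLog]
      linarith
  calc entropy P ≤ ∑ θ, (P.real {θ} * Real.log N + (N⁻¹ - P.real {θ})) :=
        Finset.sum_le_sum fun θ _ => h θ
    _ = Real.log N := by
        rw [Finset.sum_add_distrib, Finset.sum_sub_distrib, ← Finset.sum_mul,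
          sum_measureReal_singleton]
        simp [← hN, hNpos.ne']

end
end MinimaxRL

theorem mainTheorem6 {S A O Y : Type*}
    [MeasurableSpace S] [MeasurableSpace A] [MeasurableSpace O] [MeasurableSpace Y]
    [DiscreteMeasurableSpace S] [DiscreteMeasurableSpace A] [DiscreteMeasurableSpace O]
    [Finite S] [Fintype A] [Fintype O] [Nonempty A] [Nonempty O]
    (M : MinimaxRL.MDP S A O Y) (hM : M.IsContextualBandit)
    (hr : ∀ y a, M.reward y a ∈ Set.Icc (0 : ℝ) 1) :
    (∀ (P : MeasureTheory.Measure O) [MeasureTheory.IsProbabilityMeasure P],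
      (∃ f : S × O → A, M.IsOptimalRule P f) ∧
      (∀ (f : S × O → A) (hf : Measurable f), M.IsOptimalRule P f →
        M.bayesRegret (M.thompson P f hf) P ≤
          √((Fintype.card A : ℝ) * M.horizon * MinimaxRL.entropy P / 2)) ∧
      M.minBayesRegret P ≤ √((Fintype.card A : ℝ) * M.horizon * MinimaxRL.entropy P / 2)) ∧
    M.minimaxRegret ≤
      √((Fintype.card A : ℝ) * M.horizon * Real.log (Fintype.card O) / 2) := by
  obtain ⟨s₀⟩ : Nonempty S := nonempty_of_isProbabilityMeasure (M.init (Classical.arbitrary O))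
  -- The only place where `|A|` enters, through `1 ≤ |A|`.
  have hweak : ∀ {H : ℝ}, 0 ≤ H →
      √(M.horizon * H / 2) ≤ √((Fintype.card A : ℝ) * M.horizon * H / 2) := fun {H} hH => by
    have h1 : (1 : ℝ) ≤ Fintype.card A := by exact_mod_cast Fintype.card_pos (α := A)
    have h2 : (0 : ℝ) ≤ M.horizon * H := by positivity
    apply Real.sqrt_le_sqrt
    rw [mul_assoc]
    linarith [mul_le_mul_of_nonneg_right h1 h2]
  have hent : ∀ (P : Measure O) [IsProbabilityMeasure P], 0 ≤ MinimaxRL.entropy P := fun P _ =>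
    Finset.sum_nonneg fun θ _ => Real.negMulLog_nonneg measureReal_nonneg measureReal_le_one
  have hmin : ∀ (P : Measure O) [IsProbabilityMeasure P],
      M.minBayesRegret P ≤ √(M.horizon * MinimaxRL.entropy P / 2) := fun P _ => by
    obtain ⟨f, hf⟩ := M.exists_isOptimalRule P
    exact (M.minBayesRegret_le hr P (M.greedy P)).trans
      (M.bayesRegret_le_of_sampledReward_le hM hr s₀ P hf _
        (M.sampledReward_le_stepUtility_greedy hr P f))
  refine ⟨fun P _ => ⟨M.exists_isOptimalRule P, fun f hf hopt => ?_,
    (hmin P).trans (hweak (hent P))⟩, ?_⟩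
  · refine (M.bayesRegret_le_of_sampledReward_le hM hr s₀ P hopt _ fun t => ?_).trans
      (hweak (hent P))
    -- For Thompson sampling the required one-step comparison is an equality.
    simp only [M.stepUtility_thompson P f hf t, le_refl]
  · refine (M.minimaxRegret_le hr fun P _ => (hmin P).trans ?_).trans
      (hweak (Real.log_nonneg (by exact_mod_cast Fintype.card_pos (α := O))))
    gcongr
    exact MinimaxRL.entropy_le_log_card P
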